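/- Let $a>0$, let $q_1:[-a,a]\to\mathbb{C}$ be continuous, and let $f$ be a solution of $f''-q_1f=0$ on $[-a,a]$ such that $f(x)\neq 0$ for all $x\in[-a,a]$ and $f(0)=1$. Put $h=f'(0)\in\mathbb{C}$ and $q_2=2(f'/f)^2-q_1$, so that $A_2=\frac{d^2}{dx^2}-q_2$ is the Darboux transformation of $A_1=\frac{d^2}{dx^2}-q_1$ with respect to $f$. For a continuous potential $q:[-a,a]\to\mathbb{C}$ let $H$ be the unique solution, on $|u|+|v|\le a$, of the Goursat problem $$\frac{\partial^2H(u,v)}{\partial u\,\partial v}=q(u+v)H(u,v),\qquad H(u,0)=\frac12\int_0^uq(s)\,ds,\qquad H(0,v)=0,$$ let $K(x,t)=H\big(\frac{x+t}2,\frac{x-t}2\big)$, and for $\kappa\in\mathbb{C}$ let $$\mathbf{K}(x,t;\kappa)=\frac{\kappa}2+K(x,t)+\frac{\kappa}2\int_t^x\big(K(x,s)-K(x,-s)\big)\,ds .$$ The transmutation operator with parameter $\kappa$ associated with $\frac{d^2}{dx^2}-q$ is $$u\mapsto u(x)+\int_{-x}^x\mathbf{K}(x,t;\kappa)\,u(t)\,dt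 .$$ Denote by $\mathbf{T}_1=\mathbf{T}_{1;h}$ this operator for $q=q_1$, $\kappa=h$, and by $\mathbf{T}_2=\mathbf{T}_{2;-h}$ this operator for $q=q_2$, $\kappa=-h$. Define $$T_2[u](x)=\frac1{f(x)}\bigg(\int_0^xf(\eta)\,\mathbf{T}_1[u'](\eta)\,d\eta+u(0)\bigg).$$ Then: 1. for every $\omega\in\mathbb{C}$ and every solution $u$ of $u''+\omega^2u=0$ on $[-a,a]$, $T_2[u](x)=\mathbf{T}_{2;-h}[u](x)$ for all $x\in[-a,a]$; 2. $T_2[u](x)=\mathbf{T}_{2;-h}[u](x)$ for all $u\in C^1[-a,a]$ and all $x\in[-a,a]$. -/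

import Mathlib

namespace Transmutation

/-- `u` is a solution of `u'' - q u + ω² u = 0` on the segment `[-a, a]`: it is twice differentiable
there (one-sidedly at the end points) and satisfies the equation at every point. -/
structure IsSolutionOn (a : ℝ) (q : ℝ → ℂ) (ω : ℂ) (u : ℝ → ℂ) : Prop where
  differentiableOn : DifferentiableOn ℝ u (Set.Icc (-a) a)
  equation : ∀ x ∈ Set.Icc (-a) a,
    HasDerivWithinAt (derivWithin u (Set.Icc (-a) a)) (q x * u x - ω ^ 2 * u x)
      (Set.Icc (-a) a) x

/-- `H` is a classical solution, on the square `|u| + |v| ≤ a`, of the Goursat problem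
`∂²H/∂u∂v = q(u+v) H`, `H(u,0) = (1/2) ∫₀ᵘ q`, `H(0,v) = 0`: it is continuous on the closed square,
and at every interior point the derivatives `∂H/∂v` and `∂/∂u (∂H/∂v)` exist and the equation
holds. -/
structure IsGoursatSolution (a : ℝ) (q : ℝ → ℂ) (H : ℝ → ℝ → ℂ) : Prop where
  continuousOn : ContinuousOn (fun p : ℝ × ℝ => H p.1 p.2) {p : ℝ × ℝ | |p.1| + |p.2| ≤ a}
  differentiableAt : ∀ u v : ℝ, |u| + |v| < a → DifferentiableAt ℝ (fun v' => H u v') v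
  equation : ∀ u v : ℝ, |u| + |v| < a →
    HasDerivAt (fun u' => deriv (fun v' => H u' v') v) (q (u + v) * H u v) u
  left : ∀ u : ℝ, |u| ≤ a → H u 0 = (1 / 2) * ∫ s in (0 : ℝ)..u, q s
  right : ∀ v : ℝ, |v| ≤ a → H 0 v = 0

/-- The solution of the Goursat problem. For `q` continuous on `[-a, a]` it exists and is unique
on the square `|u| + |v| ≤ a`; only its values on this square are used below. -/
noncomputable def goursatSolution (a : ℝ) (q : ℝ → ℂ) : ℝ → ℝ → ℂ :=
  Classical.epsilon (IsGoursatSolution a q)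

/-- The kernel `K(x,t) = H((x+t)/2, (x-t)/2)`. -/
noncomputable def kernel (a : ℝ) (q : ℝ → ℂ) (x t : ℝ) : ℂ :=
  goursatSolution a q ((x + t) / 2) ((x - t) / 2)

/-- The kernel `𝐊(x,t;h) = h/2 + K(x,t) + (h/2) ∫ₜˣ (K(x,s) - K(x,-s)) ds`. -/
noncomputable def kernelParam (a : ℝ) (q : ℝ → ℂ) (h : ℂ) (x t : ℝ) : ℂ :=
  h / 2 + kernel a q x t + h / 2 * ∫ s in t..x, (kernel a q x s - kernel a q x (-s))

/-- The transmutation operator `𝐓_h u(x) = u(x) + ∫_{-x}^{x} 𝐊(x,t;h) u(t) dt` of the operator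
`d²/dx² - q(x)` on `[-a, a]`. -/
noncomputable def transmutation (a : ℝ) (q : ℝ → ℂ) (h : ℂ) (u : ℝ → ℂ) (x : ℝ) : ℂ :=
  u x + ∫ t in (-x)..x, kernelParam a q h x t * u t

/-- The potential `q₂ = 2 (f'/f)² - q₁` of the Darboux transformed operator. -/
noncomputable def darbouxPotential (a : ℝ) (q₁ f : ℝ → ℂ) (x : ℝ) : ℂ :=
  2 * (derivWithin f (Set.Icc (-a) a) x / f x) ^ 2 - q₁ x

/-- The operator `T₂[u](x) = (1/f(x)) (∫₀ˣ f(η) 𝐓_{1;h}[u'](η) dη + u(0))`. -/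
noncomputable def T₂ (a : ℝ) (q₁ f : ℝ → ℂ) (h : ℂ) (u : ℝ → ℂ) (x : ℝ) : ℂ :=
  1 / f x *
    ((∫ η in (0 : ℝ)..x, f η * transmutation a q₁ h (derivWithin u (Set.Icc (-a) a)) η) + u 0)

end Transmutation

/-!
Both operators intertwine `d²/dx²` with `d²/dx² - q₂` and send `u` to a function with the Cauchy
data `u(0)`, `u'(0) - h u(0)` at `0`; hence they agree on polynomials, and by continuity on `C¹`.

For a continuous potential `q` the kernel `K` is only of class `C¹`, so the intertwining relation
`(𝐓 φ)'' = q 𝐓 φ + 𝐓 φ''` cannot be obtained by differentiating `K` twice. In characteristic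
coordinates `𝐓_0 φ(x) = φ(x) + 2 ∫₀ˣ H(x-s,s) φ(x-2s) ds`; the first derivative contains the term
`∫₀ˣ H_u(r,x-r) φ(2r-x) dr`, whose integrand depends on `x` only through the `v`-variable of `H_u`,
and `∂H_u/∂v = q(u+v) H` does exist. The remaining terms containing `H_u` cancel
(`GoursatPlane.hasDerivAt_planeTransmutationDeriv`). The parameter is removed by an integration by
parts, `𝐓_κ v = 𝐓_0 [v + (κ/2) ∫_{-x}^{x} v]` (`transmutation_eq_planeTransmutation`).

To differentiate freely up to the boundary, `q` is extended continuously to the line and the Goursat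
problem is solved on the whole plane by successive approximations (`exists_goursatPlane`); uniqueness
on the square (`IsGoursatSolution.unique`) identifies its restriction with the function `H` that
defines the kernel.

For `T₂` the relation follows from the one for `𝐓_{1;h}` and the identity `f w' - f' w = f T₂[u'']`
with `w = 𝐓_{1;h}[u']` (`exists_T₂_ode`). The difference `E` of the two operators therefore satisfies
`E[u]'' = q₂ E[u] + E[u'']` with zero Cauchy data, and for a polynomial `u` it vanishes by induction
(`T₂_eq_transmutation_polynomial`). A `C¹` function is approximated by polynomials together with its
derivative, and solutions of `u'' + ω² u = 0` are of class `C¹`.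
-/

namespace Transmutation

open Set Filter Topology MeasureTheory

/-! ### Integrals depending on a parameter -/

theorem continuous_intervalIntegral_param {X : Type*} [TopologicalSpace X] {F : X → ℝ → ℂ}
    (hF : Continuous (Function.uncurry F)) {α β : X → ℝ} (hα : Continuous α) (hβ : Continuous β) :
    Continuous fun x => ∫ r in α x..β x, F x r := by
  have key : ∀ x, ∫ r in α x..β x, F x r
      = (∫ r in (0 : ℝ)..β x, F x r) - ∫ r in (0 : ℝ)..α x, F x r := by
    intro x
    have hx : Continuous (F x) := hF.comp (by fun_prop : Continuous fun r => (x, r))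
    exact (intervalIntegral.integral_interval_sub_left (hx.intervalIntegrable _ _)
      (hx.intervalIntegrable _ _)).symm
  simp only [key]
  exact (intervalIntegral.continuous_parametric_intervalIntegral_of_continuous hF hβ).sub
    (intervalIntegral.continuous_parametric_intervalIntegral_of_continuous hF hα)

theorem hasDerivAt_intervalIntegral_param {F F' : ℝ → ℝ → ℂ}
    (hF : Continuous (Function.uncurry F)) (hF' : Continuous (Function.uncurry F'))
    (hd : ∀ x r, HasDerivAt (fun x => F x r) (F' x r) x) (α β x : ℝ) :
    HasDerivAt (fun x => ∫ r in α..β, F x r) (∫ r in α..β, F' x r) x := by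
  have hc : IsCompact (Icc (x - 1) (x + 1) ×ˢ uIcc α β) := isCompact_Icc.prod isCompact_uIcc
  obtain ⟨C, hC⟩ := hc.exists_bound_of_continuousOn hF'.continuousOn
  have hs : ∀ y, Continuous (F y) := fun y => hF.comp (by fun_prop : Continuous fun r => (y, r))
  have hs' : ∀ y, Continuous (F' y) := fun y => hF'.comp (by fun_prop : Continuous fun r => (y, r))
  refine (intervalIntegral.hasDerivAt_integral_of_dominated_loc_of_deriv_le (bound := fun _ => C)
    (s := Icc (x - 1) (x + 1)) (Icc_mem_nhds (by linarith) (by linarith))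
    (Eventually.of_forall fun y => (hs y).aestronglyMeasurable)
    ((hs x).intervalIntegrable _ _) (hs' x).aestronglyMeasurable
    (Eventually.of_forall fun t ht y hy => hC (y, t) ⟨hy, uIoc_subset_uIcc ht⟩)
    (by simp) (Eventually.of_forall fun t _ y _ => hd y t)).2

/-- The Leibniz rule for an integral whose upper end point and integrand both move. -/
theorem hasDerivAt_intervalIntegral_leibniz {F F' : ℝ → ℝ → ℂ}
    (hF : Continuous (Function.uncurry F)) (hF' : Continuous (Function.uncurry F'))
    (hd : ∀ x r, HasDerivAt (fun x => F x r) (F' x r) x) (x : ℝ) :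
    HasDerivAt (fun x => ∫ r in (0 : ℝ)..x, F x r) (F x x + ∫ r in (0 : ℝ)..x, F' x r) x := by
  have hs : ∀ y, Continuous (F y) := fun y => hF.comp (by fun_prop : Continuous fun r => (y, r))
  let G₁ : ℝ → ℝ → ℝ →L[ℝ] ℂ := fun y z =>
    ContinuousLinearMap.toSpanSingleton ℝ (∫ r in (0 : ℝ)..z, F' y r)
  let G₂ : ℝ → ℝ → ℝ →L[ℝ] ℂ := fun y z => ContinuousLinearMap.toSpanSingleton ℝ (F y z)
  have c₁ : Continuous (Function.uncurry G₁) := by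
    refine (ContinuousLinearMap.toSpanSingletonCLE (𝕜 := ℝ) (E := ℂ)).continuous.comp
      (continuous_intervalIntegral_param
        (F := fun (p : ℝ × ℝ) r => F' p.1 r) ?_ continuous_const continuous_snd)
    exact hF'.comp (by fun_prop : Continuous fun p : (ℝ × ℝ) × ℝ => (p.1.1, p.2))
  have c₂ : Continuous (Function.uncurry G₂) :=
    (ContinuousLinearMap.toSpanSingletonCLE (𝕜 := ℝ) (E := ℂ)).continuous.comp hF
  have hG := hasStrictFDerivAt_uncurry_coprod (𝕜 := ℝ) (u := (x, x))
    (f := fun y z => ∫ r in (0 : ℝ)..z, F y r) (f₁ := G₁) (f₂ := G₂)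
    (Eventually.of_forall fun p =>
      (hasDerivAt_intervalIntegral_param hF hF' hd 0 p.2 p.1).hasFDerivAt)
    (Eventually.of_forall fun p =>
      ((hs p.1).integral_hasStrictDerivAt 0 p.2).hasDerivAt.hasFDerivAt)
    c₁.continuousAt c₂.continuousAt
  have hdiag : HasDerivAt (fun y : ℝ => (y, y)) ((1 : ℝ), (1 : ℝ)) x :=
    (hasDerivAt_id x).prodMk (hasDerivAt_id x)
  have := HasFDerivAt.comp_hasDerivAt (f := fun y : ℝ => (y, y)) x hG.hasFDerivAt hdiag
  refine this.congr_deriv ?_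
  simp [G₁, G₂, Function.HasUncurry.uncurry, add_comm]

/-! ### The Goursat problem on the whole plane -/

/-- A solution `H` on the whole plane of `∂²H/∂u∂v = q(u+v) H`, `H(u,0) = (1/2) ∫₀ᵘ q`,
`H(0,v) = 0`, with its continuous partial derivatives `Hu` and `Hv`. For a merely continuous `q`
the mixed derivatives exist in both orders, although `Hu` has no `u`-derivative. -/
structure GoursatPlane (q : ℝ → ℂ) (H Hu Hv : ℝ → ℝ → ℂ) : Prop where
  continuous : Continuous (Function.uncurry H)
  continuous_left : Continuous (Function.uncurry Hu)
  hasDerivAt_left : ∀ u v, HasDerivAt (fun u => H u v) (Hu u v) u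
  hasDerivAt_right : ∀ u v, HasDerivAt (fun v => H u v) (Hv u v) v
  left_right : ∀ u v, HasDerivAt (fun v => Hu u v) (q (u + v) * H u v) v
  right_left : ∀ u v, HasDerivAt (fun u => Hv u v) (q (u + v) * H u v) u
  apply_zero : ∀ u, H u 0 = (1 / 2) * ∫ s in (0 : ℝ)..u, q s
  zero_apply : ∀ v, H 0 v = 0
  left_zero : ∀ u, Hu u 0 = q u / 2

/-- The successive approximations for the integral form of the Goursat problem. -/
noncomputable def goursatIterate (q : ℝ → ℂ) : ℕ → ℝ → ℝ → ℂ
  | 0, u, _ => (1 / 2) * ∫ s in (0 : ℝ)..u, q s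
  | n + 1, u, v => ∫ s in (0 : ℝ)..u, ∫ r in (0 : ℝ)..v, q (s + r) * goursatIterate q n s r

theorem continuous_potential_mul {q : ℝ → ℂ} (hq : Continuous q) {H : ℝ → ℝ → ℂ}
    (hH : Continuous (Function.uncurry H)) :
    Continuous (Function.uncurry fun s r => q (s + r) * H s r) :=
  (hq.comp (by fun_prop : Continuous fun p : ℝ × ℝ => p.1 + p.2)).mul hH

theorem continuous_integral_right {F : ℝ → ℝ → ℂ} (hF : Continuous (Function.uncurry F)) :
    Continuous (Function.uncurry fun s v => ∫ r in (0 : ℝ)..v, F s r) :=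
  continuous_intervalIntegral_param (F := fun (p : ℝ × ℝ) r => F p.1 r)
    (hF.comp (by fun_prop : Continuous fun p : (ℝ × ℝ) × ℝ => (p.1.1, p.2)))
    continuous_const continuous_snd

theorem continuous_integral_integral {F : ℝ → ℝ → ℂ} (hF : Continuous (Function.uncurry F)) :
    Continuous (Function.uncurry fun u v => ∫ s in (0 : ℝ)..u, ∫ r in (0 : ℝ)..v, F s r) :=
  continuous_intervalIntegral_param (F := fun (p : ℝ × ℝ) s => ∫ r in (0 : ℝ)..p.2, F s r)
    ((continuous_integral_right hF).comp
      (by fun_prop : Continuous fun p : (ℝ × ℝ) × ℝ => (p.2, p.1.2)))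
    continuous_const continuous_fst

theorem continuous_goursatIterate {q : ℝ → ℂ} (hq : Continuous q) (n : ℕ) :
    Continuous (Function.uncurry (goursatIterate q n)) := by
  induction n with
  | zero =>
    exact continuous_const.mul ((intervalIntegral.continuous_primitive
      (fun a b => hq.intervalIntegrable a b) 0).comp continuous_fst)
  | succ n ih => exact continuous_integral_integral (continuous_potential_mul hq ih)

theorem norm_intervalIntegral_le_pow {F : ℝ → ℂ} {C u : ℝ} (n : ℕ)
    (h : ∀ s ∈ uIcc 0 u, ‖F s‖ ≤ C * (|s| ^ n / n.factorial)) :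
    ‖∫ s in (0 : ℝ)..u, F s‖ ≤ C * (|u| ^ (n + 1) / (n + 1).factorial) := by
  have hi : IntegrableOn (fun s : ℝ => C * (|s| ^ n / n.factorial)) (uIoc 0 u) :=
    (Continuous.continuousOn (by fun_prop)).integrableOn_compact isCompact_uIcc |>.mono_set
      uIoc_subset_uIcc
  calc ‖∫ s in (0 : ℝ)..u, F s‖ ≤ ∫ s in uIoc 0 u, C * (|s| ^ n / n.factorial) := by
        rw [intervalIntegral.norm_intervalIntegral_eq]
        refine norm_integral_le_of_norm_le hi ?_
        filter_upwards [ae_restrict_mem measurableSet_uIoc] with s hs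
        exact h s (uIoc_subset_uIcc hs)
    _ = C * (|u| ^ (n + 1) / (n + 1).factorial) := by
        have := integral_pow_abs_sub_uIoc (a := 0) (b := u) n
        simp only [sub_zero] at this
        rw [integral_const_mul, integral_div, this, Nat.factorial_succ]
        push_cast
        field_simp

theorem norm_goursatIterate_le {q : ℝ → ℂ} (hq : Continuous q) {R : ℝ} (hR : 0 ≤ R) :
    ∃ C L : ℝ, 0 ≤ C ∧ 0 ≤ L ∧ ∀ n, ∀ u ∈ Icc (-R) R, ∀ v ∈ Icc (-R) R,
      ‖goursatIterate q n u v‖ ≤ C * L ^ n * (|u| ^ n / n.factorial) := by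
  obtain ⟨M, hM⟩ := (isCompact_Icc (a := -(2 * R)) (b := 2 * R)).exists_bound_of_continuousOn
    hq.continuousOn
  obtain ⟨C, hC⟩ := ((isCompact_Icc (a := -R) (b := R)).prod
    (isCompact_Icc (a := -R) (b := R))).exists_bound_of_continuousOn
    (continuous_goursatIterate hq 0).continuousOn
  have h0 : (0 : ℝ) ∈ Icc (-R) R := ⟨by linarith, hR⟩
  have hM0 : 0 ≤ M := (norm_nonneg _).trans (hM 0 ⟨by linarith, by linarith⟩)
  have hC0 : 0 ≤ C := (norm_nonneg _).trans (hC (0, 0) ⟨h0, h0⟩)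
  refine ⟨C, M * R, hC0, by positivity, fun n => ?_⟩
  induction n with
  | zero => intro u hu v hv; simpa using hC (u, v) ⟨hu, hv⟩
  | succ n ih =>
    intro u hu v hv
    refine norm_intervalIntegral_le_pow n fun s hs => ?_
    have hs' : s ∈ Icc (-R) R := (uIcc_subset_Icc h0 hu) hs
    have hb : ∀ r ∈ uIoc 0 v, ‖q (s + r) * goursatIterate q n s r‖
        ≤ M * (C * (M * R) ^ n * (|s| ^ n / n.factorial)) := by
      intro r hr
      have hr' : r ∈ Icc (-R) R := (uIcc_subset_Icc h0 hv) (uIoc_subset_uIcc hr)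
      rw [norm_mul]
      exact mul_le_mul (hM _ ⟨by linarith [hs'.1, hr'.1], by linarith [hs'.2, hr'.2]⟩)
        (ih s hs' r hr') (norm_nonneg _) hM0
    refine (intervalIntegral.norm_integral_le_of_norm_le_const hb).trans ?_
    have hv' : |v - 0| ≤ R := by rw [sub_zero]; exact abs_le.2 hv
    refine (mul_le_mul_of_nonneg_left hv' (by positivity)).trans (le_of_eq ?_)
    ring

/-- The integral form of the Goursat problem is solved by the sum of the successive approximations,
which converges locally uniformly. -/
theorem exists_goursat_integral {q : ℝ → ℂ} (hq : Continuous q) :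
    ∃ H : ℝ → ℝ → ℂ, Continuous (Function.uncurry H) ∧ ∀ u v, H u v =
      (1 / 2) * (∫ s in (0 : ℝ)..u, q s) +
        ∫ s in (0 : ℝ)..u, ∫ r in (0 : ℝ)..v, q (s + r) * H s r := by
  have bound : ∀ R : ℝ, 0 ≤ R → ∃ c : ℕ → ℝ, Summable c ∧
      ∀ n, ∀ u ∈ Icc (-R) R, ∀ v ∈ Icc (-R) R, ‖goursatIterate q n u v‖ ≤ c n := by
    intro R hR
    obtain ⟨C, L, hC, hL, h⟩ := norm_goursatIterate_le hq hR
    refine ⟨fun n => C * ((L * R) ^ n / n.factorial),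
      (Real.summable_pow_div_factorial (L * R)).mul_left C, fun n u hu v hv =>
      (h n u hu v hv).trans ?_⟩
    have : |u| ^ n ≤ R ^ n := pow_le_pow_left₀ (abs_nonneg _) (abs_le.2 hu) n
    calc C * L ^ n * (|u| ^ n / n.factorial) ≤ C * L ^ n * (R ^ n / n.factorial) := by gcongr
      _ = C * ((L * R) ^ n / n.factorial) := by rw [mul_pow]; ring
  have hsum : ∀ u v, Summable fun n => goursatIterate q n u v := by
    intro u v
    obtain ⟨c, hc, h⟩ := bound (max |u| |v|) (by positivity)
    exact hc.of_norm_bounded fun n => h n u (abs_le.1 (le_max_left _ _)) v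
      (abs_le.1 (le_max_right _ _))
  refine ⟨fun u v => ∑' n, goursatIterate q n u v, ?_, fun u v => ?_⟩
  · rw [continuous_iff_continuousAt]
    rintro ⟨u, v⟩
    obtain ⟨c, hc, h⟩ := bound (max |u| |v| + 1) (by positivity)
    have hcont : ContinuousOn (fun p : ℝ × ℝ => ∑' n, goursatIterate q n p.1 p.2)
        (Icc (-(max |u| |v| + 1)) (max |u| |v| + 1) ×ˢ
          Icc (-(max |u| |v| + 1)) (max |u| |v| + 1)) :=
      continuousOn_tsum (fun n => (continuous_goursatIterate hq n).continuousOn) hc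
        fun n p hp => h n p.1 hp.1 p.2 hp.2
    have hu := abs_le.1 (le_max_left |u| |v|)
    have hv := abs_le.1 (le_max_right |u| |v|)
    exact hcont.continuousAt (prod_mem_nhds
      (Icc_mem_nhds (by linarith [hu.1]) (by linarith [hu.2]))
      (Icc_mem_nhds (by linarith [hv.1]) (by linarith [hv.2])))
  · set R := max |u| |v| with hR
    have hR0 : 0 ≤ R := by positivity
    have h0 : (0 : ℝ) ∈ Icc (-R) R := ⟨by linarith, hR0⟩
    have hu : u ∈ Icc (-R) R := abs_le.1 (le_max_left _ _)
    have hv : v ∈ Icc (-R) R := abs_le.1 (le_max_right _ _)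
    obtain ⟨c, hc, h⟩ := bound R hR0
    obtain ⟨M, hM⟩ := (isCompact_Icc (a := -(2 * R)) (b := 2 * R)).exists_bound_of_continuousOn
      hq.continuousOn
    have hM0 : 0 ≤ M := (norm_nonneg _).trans (hM 0 ⟨by linarith, by linarith⟩)
    have hF : ∀ n, Continuous (Function.uncurry fun s r => q (s + r) * goursatIterate q n s r) :=
      fun n => continuous_potential_mul hq (continuous_goursatIterate hq n)
    have hb : ∀ n, ∀ s ∈ uIoc 0 u, ∀ r ∈ uIoc 0 v,
        ‖q (s + r) * goursatIterate q n s r‖ ≤ M * c n := by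
      intro n s hs r hr
      have hs' : s ∈ Icc (-R) R := (uIcc_subset_Icc h0 hu) (uIoc_subset_uIcc hs)
      have hr' : r ∈ Icc (-R) R := (uIcc_subset_Icc h0 hv) (uIoc_subset_uIcc hr)
      rw [norm_mul]
      exact mul_le_mul (hM _ ⟨by linarith [hs'.1, hr'.1], by linarith [hs'.2, hr'.2]⟩)
        (h n s hs' r hr') (norm_nonneg _) hM0
    have inner : ∀ s ∈ uIoc 0 u, HasSum
        (fun n => ∫ r in (0 : ℝ)..v, q (s + r) * goursatIterate q n s r)
        (∫ r in (0 : ℝ)..v, q (s + r) * ∑' n, goursatIterate q n s r) := by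
      intro s hs
      refine intervalIntegral.hasSum_integral_of_dominated_convergence (fun n _ => M * c n)
        (fun n => ((hF n).comp
          (by fun_prop : Continuous fun r => (s, r))).aestronglyMeasurable)
        (fun n => Eventually.of_forall fun r hr => hb n s hs r hr)
        (Eventually.of_forall fun _ _ => hc.mul_left M) (by simp)
        (Eventually.of_forall fun r _ => ((hsum s r).hasSum.mul_left _))
    have outer : HasSum (fun n => goursatIterate q (n + 1) u v)
        (∫ s in (0 : ℝ)..u, ∫ r in (0 : ℝ)..v, q (s + r) * ∑' n, goursatIterate q n s r) := by
      refine intervalIntegral.hasSum_integral_of_dominated_convergence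
        (fun n _ => M * c n * |v - 0|)
        (fun n => ((continuous_integral_right (hF n)).comp
          (by fun_prop : Continuous fun s => (s, v))).aestronglyMeasurable)
        (fun n => Eventually.of_forall fun s hs =>
          intervalIntegral.norm_integral_le_of_norm_le_const (hb n s hs))
        (Eventually.of_forall fun _ _ => (hc.mul_left M).mul_right _) (by simp)
        (Eventually.of_forall fun s hs => inner s hs)
    exact (hsum u v).tsum_eq_zero_add.trans (by rw [outer.tsum_eq]; rfl)

theorem exists_goursatPlane {q : ℝ → ℂ} (hq : Continuous q) :
    ∃ H Hu Hv, GoursatPlane q H Hu Hv := by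
  obtain ⟨H, hH, heq⟩ := exists_goursat_integral hq
  have hF := continuous_potential_mul hq hH
  have hFs : Continuous (Function.uncurry fun r s => q (s + r) * H s r) :=
    hF.comp continuous_swap
  have hA := continuous_integral_right hF
  have hB := continuous_integral_right hFs
  refine ⟨H, fun u v => q u / 2 + ∫ r in (0 : ℝ)..v, q (u + r) * H u r,
    fun u v => ∫ s in (0 : ℝ)..u, q (s + v) * H s v, hH, ?_, ?_, ?_, ?_, ?_, ?_, ?_, ?_⟩
  · exact ((hq.comp continuous_fst).div_const 2).add hA
  · intro u v
    have h1 := ((hq.integral_hasStrictDerivAt 0 u).hasDerivAt.const_mul (1 / 2 : ℂ)).add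
      ((hA.comp (by fun_prop : Continuous fun s => (s, v))).integral_hasStrictDerivAt 0 u).hasDerivAt
    refine (h1.congr_of_eventuallyEq (Eventually.of_forall fun u => heq u v)).congr_deriv ?_
    simp only [Function.comp, Function.uncurry]
    ring
  · intro u v
    have h1 := ((hB.comp
      (by fun_prop : Continuous fun r => (r, u))).integral_hasStrictDerivAt 0 v).hasDerivAt.const_add
      ((1 / 2) * ∫ s in (0 : ℝ)..u, q s)
    refine h1.congr_of_eventuallyEq (Eventually.of_forall fun v => ?_)
    dsimp only [Function.comp, Function.uncurry]
    rw [heq u v, intervalIntegral_intervalIntegral_swap (hF.continuousOn.integrableOn_compact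
      (isCompact_uIcc.prod isCompact_uIcc) |>.mono_set
      (prod_mono uIoc_subset_uIcc uIoc_subset_uIcc))]
  · intro u v
    exact ((hF.comp
      (by fun_prop : Continuous fun r => (u, r))).integral_hasStrictDerivAt 0 v).hasDerivAt.const_add _
  · intro u v
    exact ((hF.comp
      (by fun_prop : Continuous fun s => (s, v))).integral_hasStrictDerivAt 0 u).hasDerivAt
  · intro u; rw [heq]; simp
  · intro v; rw [heq]; simp
  · intro u; simp

/-! ### Uniqueness on the square -/

theorem add_mem_Icc_of_abs {a u v : ℝ} (h : |u| + |v| ≤ a) : u + v ∈ Icc (-a) a :=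
  abs_le.1 ((abs_add_le u v).trans h)

theorem GoursatPlane.isGoursatSolution {a : ℝ} {q Q : ℝ → ℂ} {H Hu Hv : ℝ → ℝ → ℂ}
    (hH : GoursatPlane Q H Hu Hv) (hqQ : EqOn q Q (Icc (-a) a)) : IsGoursatSolution a q H where
  continuousOn := hH.continuous.continuousOn
  differentiableAt u v _ := (hH.hasDerivAt_right u v).differentiableAt
  equation u v huv := by
    have h1 : (fun u' => deriv (fun v' => H u' v') v) = fun u' => Hv u' v :=
      funext fun u' => (hH.hasDerivAt_right u' v).deriv
    rw [h1, hqQ (add_mem_Icc_of_abs huv.le)]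
    exact hH.right_left u v
  left u hu := by
    rw [hH.apply_zero, intervalIntegral.integral_congr fun s hs => hqQ ?_]
    have := abs_sub_left_of_mem_uIcc hs
    rw [sub_zero, sub_zero] at this
    exact abs_le.1 (this.trans hu)
  right v _ := hH.zero_apply v

/-- The difference of two solutions satisfies `D(u,v) = ∫₀ᵛ ∫₀ᵘ q D`, and iterating this bounds it
by the terms of an exponential series. -/
theorem IsGoursatSolution.norm_sub_le {a : ℝ} {q : ℝ → ℂ} {H₁ H₂ : ℝ → ℝ → ℂ}
    (h₁ : IsGoursatSolution a q H₁) (h₂ : IsGoursatSolution a q H₂) {C M : ℝ}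
    (hq : ContinuousOn q (Icc (-a) a)) (hM : ∀ x ∈ Icc (-a) a, ‖q x‖ ≤ M)
    (hC : ∀ u v, |u| + |v| < a → ‖H₁ u v - H₂ u v‖ ≤ C) (n : ℕ) :
    ∀ u v, |u| + |v| < a →
      ‖H₁ u v - H₂ u v‖ ≤ C * (M * a) ^ n * (|u| ^ n / n.factorial) := by
  induction n with
  | zero => intro u v huv; simpa using hC u v huv
  | succ n ih =>
    intro u v huv
    have ha : 0 < a := lt_of_le_of_lt (by positivity) huv
    have hM0 : 0 ≤ M := (norm_nonneg _).trans (hM 0 ⟨by linarith, ha.le⟩)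
    have hC0 : 0 ≤ C := (norm_nonneg _).trans (hC 0 0 (by simpa using ha))
    let G : ℝ → ℝ → ℂ := fun u v => deriv (fun v' => H₁ u v') v - deriv (fun v' => H₂ u v') v
    have hG : ∀ u v, |u| + |v| < a →
        HasDerivAt (fun u => G u v) (q (u + v) * (H₁ u v - H₂ u v)) u := fun u v huv =>
      ((h₁.equation u v huv).sub (h₂.equation u v huv)).congr_deriv (by ring)
    have hG0 : ∀ v, |v| < a → G 0 v = 0 := by
      intro v hv
      have hz : ∀ {H : ℝ → ℝ → ℂ}, IsGoursatSolution a q H → deriv (fun v' => H 0 v') v = 0 := by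
        intro H hH
        have : (fun v' => H 0 v') =ᶠ[𝓝 v] fun _ => 0 := by
          filter_upwards [continuous_abs.continuousAt.eventually_lt_const hv] with w hw
          exact hH.right w hw.le
        rw [this.deriv_eq, deriv_const]
      simp [G, hz h₁, hz h₂]
    have hGb : ∀ w ∈ uIcc 0 v,
        ‖G u w‖ ≤ M * (C * (M * a) ^ n) * (|u| ^ (n + 1) / (n + 1).factorial) := by
      intro w hw
      have hwv : |w| ≤ |v| := by simpa using abs_sub_left_of_mem_uIcc hw
      have hs : ∀ s ∈ uIcc 0 u, |s| + |w| < a := by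
        intro s hs
        have : |s| ≤ |u| := by simpa using abs_sub_left_of_mem_uIcc hs
        linarith
      have hc : ContinuousOn (fun s => q (s + w) * (H₁ s w - H₂ s w)) (uIcc 0 u) := by
        refine (hq.comp (by fun_prop) fun s h => add_mem_Icc_of_abs (hs s h).le).mul ?_
        have hp : MapsTo (fun s => (s, w)) (uIcc 0 u) {p : ℝ × ℝ | |p.1| + |p.2| ≤ a} :=
          fun s h => (hs s h).le
        exact (h₁.continuousOn.comp (f := fun s => (s, w)) (by fun_prop) hp).sub
          (h₂.continuousOn.comp (f := fun s => (s, w)) (by fun_prop) hp)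
      have hint := intervalIntegral.integral_eq_sub_of_hasDerivAt
        (fun s h => hG s w (hs s h)) hc.intervalIntegrable
      rw [hG0 w (by linarith [abs_nonneg u]), sub_zero] at hint
      rw [← hint]
      refine norm_intervalIntegral_le_pow n fun s h => ?_
      rw [norm_mul, mul_assoc M]
      exact mul_le_mul (hM _ (add_mem_Icc_of_abs (hs s h).le)) (ih s w (hs s h))
        (norm_nonneg _) hM0
    have hD := (convex_uIcc 0 v).norm_image_sub_le_of_norm_hasDerivWithin_le
      (f := fun w => H₁ u w - H₂ u w) (f' := fun w => G u w)
      (fun w hw => by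
        have hwv : |w| ≤ |v| := by simpa using abs_sub_left_of_mem_uIcc hw
        exact ((h₁.differentiableAt u w (by linarith)).hasDerivAt.sub
          (h₂.differentiableAt u w (by linarith)).hasDerivAt).hasDerivWithinAt)
      hGb left_mem_uIcc right_mem_uIcc
    have hu : |u| ≤ a := by linarith [abs_nonneg v]
    rw [h₁.left u hu, h₂.left u hu, sub_self, sub_zero, sub_zero] at hD
    refine hD.trans ?_
    have hv : ‖v‖ ≤ a := by rw [Real.norm_eq_abs]; linarith [abs_nonneg u]
    refine (mul_le_mul_of_nonneg_left hv (by positivity)).trans (le_of_eq ?_)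
    ring

theorem IsGoursatSolution.unique {a : ℝ} {q : ℝ → ℂ} {H₁ H₂ : ℝ → ℝ → ℂ}
    (hq : ContinuousOn q (Icc (-a) a))
    (h₁ : IsGoursatSolution a q H₁) (h₂ : IsGoursatSolution a q H₂) {u v : ℝ}
    (huv : |u| + |v| ≤ a) : H₁ u v = H₂ u v := by
  have hK : IsCompact {p : ℝ × ℝ | |p.1| + |p.2| ≤ a} := by
    refine (isCompact_Icc.prod isCompact_Icc).of_isClosed_subset (s := Icc (-a) a ×ˢ Icc (-a) a)
      (isClosed_le (by fun_prop) continuous_const) ?_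
    intro p (hp : |p.1| + |p.2| ≤ a)
    exact ⟨abs_le.1 (by linarith [abs_nonneg p.2]), abs_le.1 (by linarith [abs_nonneg p.1])⟩
  have hDc := h₁.continuousOn.sub h₂.continuousOn
  obtain ⟨C, hC⟩ := hK.exists_bound_of_continuousOn hDc
  obtain ⟨M, hM⟩ := isCompact_Icc.exists_bound_of_continuousOn hq
  have hopen : ∀ u v, |u| + |v| < a → H₁ u v - H₂ u v = 0 := by
    intro u v huv
    have hb := h₁.norm_sub_le h₂ hq hM (fun u v h => hC (u, v) h.le)
    have ht : Tendsto (fun n : ℕ => C * (M * a) ^ n * (|u| ^ n / n.factorial)) atTop (𝓝 0) := by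
      have := (FloorSemiring.tendsto_pow_div_factorial_atTop (M * a * |u|)).const_mul C
      rw [mul_zero] at this
      refine this.congr fun n => ?_
      rw [mul_pow]; ring
    exact norm_le_zero_iff.1 (ge_of_tendsto' ht fun n => hb n u v huv)
  rcases huv.lt_or_eq with hlt | heq
  · exact sub_eq_zero.1 (hopen u v hlt)
  rcases (show 0 ≤ a from heq ▸ by positivity).eq_or_lt with ha | ha
  · have hu : u = 0 := abs_eq_zero.1 (by linarith [abs_nonneg u, abs_nonneg v])
    have hv : |v| ≤ a := by linarith [abs_nonneg u]
    rw [hu, h₁.right v hv, h₂.right v hv]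
  · -- A boundary point is reached along the ray from the centre.
    have hmaps : MapsTo (fun t : ℝ => (t * u, t * v)) (Icc 0 1)
        {p : ℝ × ℝ | |p.1| + |p.2| ≤ a} := by
      intro t ht
      have : |t * u| + |t * v| = t * a := by
        rw [abs_mul, abs_mul, abs_of_nonneg ht.1, ← heq]; ring
      show |t * u| + |t * v| ≤ a
      rw [this]
      nlinarith [ht.2]
    have hz : EqOn (fun t : ℝ => H₁ (t * u) (t * v) - H₂ (t * u) (t * v)) (fun _ => 0)
        (Ico 0 1) := by
      intro t ht
      refine hopen _ _ ?_
      rw [abs_mul, abs_mul, abs_of_nonneg ht.1, ← mul_add, heq]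
      nlinarith [ht.2]
    have := hz.of_subset_closure (t := Icc 0 1)
      (hDc.comp (f := fun t : ℝ => (t * u, t * v)) (by fun_prop) hmaps) continuousOn_const
      Ico_subset_Icc_self (by rw [closure_Ico zero_ne_one]) (right_mem_Icc.2 zero_le_one)
    simpa [sub_eq_zero] using this

/-- The kernel is the restriction of any Goursat solution for a potential extending `q`. -/
theorem kernel_eq {a : ℝ} {q Q : ℝ → ℂ} {H Hu Hv : ℝ → ℝ → ℂ} (hq : ContinuousOn q (Icc (-a) a))
    (hqQ : EqOn q Q (Icc (-a) a)) (hH : GoursatPlane Q H Hu Hv) {x t : ℝ} (hx : |x| ≤ a)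
    (ht : |t| ≤ |x|) : kernel a q x t = H ((x + t) / 2) ((x - t) / 2) := by
  have hsol := hH.isGoursatSolution hqQ
  refine IsGoursatSolution.unique hq (Classical.epsilon_spec ⟨H, hsol⟩) hsol ?_
  rw [abs_div, abs_div, abs_two]
  rcases abs_cases x with h | h <;> rcases abs_cases t with h' | h' <;>
    rcases abs_cases (x + t) with h'' | h'' <;> rcases abs_cases (x - t) with h3 | h3 <;> linarith

/-! ### The differential equation satisfied by the transmutation operator -/

/-- The operator `φ ↦ φ(x) + ∫_{-x}^{x} K(x,t) φ(t) dt`, written in the characteristic coordinates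
by the substitution `t = x - 2s`. -/
noncomputable def planeTransmutation (H : ℝ → ℝ → ℂ) (φ : ℝ → ℂ) (x : ℝ) : ℂ :=
  φ x + 2 * ∫ s in (0 : ℝ)..x, H (x - s) s * φ (x - 2 * s)

/-- The derivative of `planeTransmutation H φ`, with the integral containing `Hu = ∂H/∂u` written
so that its integrand depends on `x` only through the second argument of `Hu`: that is the
variable in which `Hu` is differentiable. -/
noncomputable def planeTransmutationDeriv (H Hu : ℝ → ℝ → ℂ) (φ φ' : ℝ → ℂ) (x : ℝ) : ℂ :=
  φ' x + 2 * ((∫ r in (0 : ℝ)..x, Hu r (x - r) * φ (2 * r - x)) +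
    ∫ s in (0 : ℝ)..x, H (x - s) s * φ' (x - 2 * s))

theorem integral_reflect (F : ℝ → ℝ → ℂ) (φ : ℝ → ℂ) (x : ℝ) :
    ∫ r in (0 : ℝ)..x, F r (x - r) * φ (2 * r - x) =
      ∫ s in (0 : ℝ)..x, F (x - s) s * φ (x - 2 * s) := by
  have := intervalIntegral.integral_comp_sub_left (a := 0) (b := x)
    (fun r => F r (x - r) * φ (2 * r - x)) x
  rw [sub_self, sub_zero] at this
  rw [← this]
  refine intervalIntegral.integral_congr fun s _ => ?_
  simp only [sub_sub_cancel, show 2 * (x - s) - x = x - 2 * s by ring]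

section PlaneTransmutation

variable {Q : ℝ → ℂ} {H Hu Hv : ℝ → ℝ → ℂ}

theorem continuous_charIntegrand {F : ℝ → ℝ → ℂ} {φ : ℝ → ℂ}
    (hF : Continuous (Function.uncurry F)) (hφ : Continuous φ) :
    Continuous (Function.uncurry fun x s => F (x - s) s * φ (x - 2 * s)) :=
  (hF.comp (by fun_prop : Continuous fun p : ℝ × ℝ => (p.1 - p.2, p.2))).mul
    (hφ.comp (by fun_prop))

theorem continuous_charIntegrand' {F : ℝ → ℝ → ℂ} {φ : ℝ → ℂ}
    (hF : Continuous (Function.uncurry F)) (hφ : Continuous φ) :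
    Continuous (Function.uncurry fun x r => F r (x - r) * φ (2 * r - x)) :=
  (hF.comp (by fun_prop : Continuous fun p : ℝ × ℝ => (p.2, p.1 - p.2))).mul
    (hφ.comp (by fun_prop))

theorem GoursatPlane.hasDerivAt_charIntegral (hH : GoursatPlane Q H Hu Hv) {φ φ' : ℝ → ℂ}
    (hφ : ∀ x, HasDerivAt φ (φ' x) x) (hφ' : Continuous φ') (x : ℝ) :
    HasDerivAt (fun x => ∫ s in (0 : ℝ)..x, H (x - s) s * φ (x - 2 * s))
      ((∫ s in (0 : ℝ)..x, Hu (x - s) s * φ (x - 2 * s)) +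
        ∫ s in (0 : ℝ)..x, H (x - s) s * φ' (x - 2 * s)) x := by
  have cφ : Continuous φ := continuous_iff_continuousAt.2 fun x => (hφ x).continuousAt
  have c0 := continuous_charIntegrand hH.continuous cφ
  have c1 := continuous_charIntegrand hH.continuous_left cφ
  have c2 := continuous_charIntegrand hH.continuous hφ'
  have h := hasDerivAt_intervalIntegral_leibniz c0
    (F' := fun x s => Hu (x - s) s * φ (x - 2 * s) + H (x - s) s * φ' (x - 2 * s)) (c1.add c2)
    (fun x s => ((hH.hasDerivAt_left (x - s) s).comp_sub_const x s).mul
      ((hφ (x - 2 * s)).comp_sub_const x (2 * s))) x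
  refine h.congr_deriv ?_
  rw [sub_self, hH.zero_apply, zero_mul, zero_add]
  exact intervalIntegral.integral_add
    ((c1.comp (by fun_prop : Continuous fun s => (x, s))).intervalIntegrable _ _)
    ((c2.comp (by fun_prop : Continuous fun s => (x, s))).intervalIntegrable _ _)

theorem GoursatPlane.hasDerivAt_planeTransmutation (hH : GoursatPlane Q H Hu Hv) {φ φ' : ℝ → ℂ}
    (hφ : ∀ x, HasDerivAt φ (φ' x) x) (hφ' : Continuous φ') (x : ℝ) :
    HasDerivAt (planeTransmutation H φ) (planeTransmutationDeriv H Hu φ φ' x) x := by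
  rw [planeTransmutationDeriv, integral_reflect]
  exact (hφ x).add ((hH.hasDerivAt_charIntegral hφ hφ' x).const_mul 2)

/-- The intertwining relation `(T φ)'' = Q T φ + T φ''`. The terms containing `Hu φ'`, which could
not be differentiated once more, cancel. -/
theorem GoursatPlane.hasDerivAt_planeTransmutationDeriv (hH : GoursatPlane Q H Hu Hv)
    {φ φ' φ'' : ℝ → ℂ} (hφ : ∀ x, HasDerivAt φ (φ' x) x) (hφ' : ∀ x, HasDerivAt φ' (φ'' x) x)
    (hφ'' : Continuous φ'') (x : ℝ) :
    HasDerivAt (planeTransmutationDeriv H Hu φ φ')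
      (Q x * planeTransmutation H φ x + planeTransmutation H φ'' x) x := by
  have cφ : Continuous φ := continuous_iff_continuousAt.2 fun x => (hφ x).continuousAt
  have cφ' : Continuous φ' := continuous_iff_continuousAt.2 fun x => (hφ' x).continuousAt
  -- `∂/∂x (Hu r (x - r)) = Q x * H r (x - r)`, since `r + (x - r) = x`.
  have hd : ∀ x r, HasDerivAt (fun x => Hu r (x - r) * φ (2 * r - x))
      (Q x * (H r (x - r) * φ (2 * r - x)) - Hu r (x - r) * φ' (2 * r - x)) x := by
    intro x r
    have h1 := (hH.left_right r (x - r)).comp_sub_const x r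
    have h2 := (hφ (2 * r - x)).comp_const_sub (2 * r) x
    refine (h1.mul h2).congr_deriv ?_
    rw [add_sub_cancel]
    ring
  have cQ : Continuous Q := by
    have : Q = fun u => 2 * Hu u 0 := funext fun u => by rw [hH.left_zero]; ring
    rw [this]
    exact continuous_const.mul
      (hH.continuous_left.comp (by fun_prop : Continuous fun u : ℝ => (u, (0 : ℝ))))
  have c0 := continuous_charIntegrand' hH.continuous_left cφ
  have c1 : Continuous (Function.uncurry fun x r => Q x * (H r (x - r) * φ (2 * r - x))) :=
    (cQ.comp continuous_fst).mul (continuous_charIntegrand' hH.continuous cφ)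
  have c2 := continuous_charIntegrand' hH.continuous_left cφ'
  have h := hasDerivAt_intervalIntegral_leibniz c0 (F' := fun x r =>
    Q x * (H r (x - r) * φ (2 * r - x)) - Hu r (x - r) * φ' (2 * r - x)) (c1.sub c2) hd x
  have hall := (hφ' x).add ((h.add (hH.hasDerivAt_charIntegral hφ' hφ'' x)).const_mul 2)
  refine hall.congr_deriv ?_
  have hsplit : ∫ r in (0 : ℝ)..x,
      (Q x * (H r (x - r) * φ (2 * r - x)) - Hu r (x - r) * φ' (2 * r - x)) =
      Q x * (∫ s in (0 : ℝ)..x, H (x - s) s * φ (x - 2 * s)) -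
        ∫ s in (0 : ℝ)..x, Hu (x - s) s * φ' (x - 2 * s) := by
    have i1 := (c1.comp (by fun_prop : Continuous fun r => (x, r))).intervalIntegrable
      (μ := volume) 0 x
    have i2 := (c2.comp (by fun_prop : Continuous fun r => (x, r))).intervalIntegrable
      (μ := volume) 0 x
    refine (intervalIntegral.integral_sub i1 i2).trans ?_
    simp only [Function.comp_apply, Function.uncurry_apply_pair]
    rw [intervalIntegral.integral_const_mul, integral_reflect, integral_reflect]
  simp only [planeTransmutation]
  rw [hsplit, sub_self, hH.left_zero, show 2 * x - x = x by ring]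
  ring

end PlaneTransmutation

/-! ### The transmutation operator with parameter -/

theorem abs_le_of_mem_uIcc_neg {x t : ℝ} (ht : t ∈ uIcc (-x) x) : |t| ≤ |x| := by
  rcases mem_uIcc.1 ht with h | h
  · exact abs_le_abs h.2 (by linarith [h.1])
  · exact (abs_le_abs (by linarith [h.1]) (by linarith [h.2])).trans_eq (abs_neg x)

theorem kernelParam_eq {a : ℝ} {q Q : ℝ → ℂ} {H Hu Hv : ℝ → ℝ → ℂ}
    (hq : ContinuousOn q (Icc (-a) a)) (hqQ : EqOn q Q (Icc (-a) a))
    (hH : GoursatPlane Q H Hu Hv) (κ : ℂ) {x t : ℝ} (hx : x ∈ Icc (-a) a)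
    (ht : t ∈ uIcc (-x) x) :
    kernelParam a q κ x t = κ / 2 + H ((x + t) / 2) ((x - t) / 2) +
      κ / 2 * ∫ s in t..x, (H ((x + s) / 2) ((x - s) / 2) - H ((x - s) / 2) ((x + s) / 2)) := by
  have hxa : |x| ≤ a := abs_le.2 hx
  rw [kernelParam, kernel_eq hq hqQ hH hxa (abs_le_of_mem_uIcc_neg ht)]
  congr 2
  refine intervalIntegral.integral_congr fun s hs => ?_
  have hs' : |s| ≤ |x| := abs_le_of_mem_uIcc_neg (uIcc_subset_uIcc ht right_mem_uIcc hs)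
  rw [kernel_eq hq hqQ hH hxa hs', kernel_eq hq hqQ hH hxa (by rwa [abs_neg]), sub_neg_eq_add,
    ← sub_eq_add_neg]

/-- Integration by parts turns the parameter `κ` of the kernel into the substitution
`v ↦ v + (κ/2) ∫_{-s}^{s} v` in the argument. -/
theorem transmutation_eq_planeTransmutation {a : ℝ} {q Q : ℝ → ℂ} {H Hu Hv : ℝ → ℝ → ℂ}
    (hq : ContinuousOn q (Icc (-a) a)) (hqQ : EqOn q Q (Icc (-a) a))
    (hH : GoursatPlane Q H Hu Hv) (κ : ℂ) {v : ℝ → ℂ} (hv : Continuous v) {x : ℝ}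
    (hx : x ∈ Icc (-a) a) :
    transmutation a q κ v x =
      planeTransmutation H (fun s => v s + κ / 2 * ∫ t in (-s)..s, v t) x := by
  set k : ℝ → ℂ := fun t => H ((x + t) / 2) ((x - t) / 2) with hk
  have ck : Continuous k :=
    hH.continuous.comp (by fun_prop : Continuous fun t : ℝ => ((x + t) / 2, (x - t) / 2))
  have ho : Continuous fun s => k s - k (-s) := ck.sub (ck.comp continuous_neg)
  set W : ℝ → ℂ := fun t => ∫ s in t..x, (k s - k (-s)) with hW
  set V : ℝ → ℂ := fun t => ∫ s in (0 : ℝ)..t, v s with hV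
  have hWd : ∀ t, HasDerivAt W (-(k t - k (-t))) t := fun t =>
    intervalIntegral.integral_hasDerivAt_left (ho.intervalIntegrable _ _)
      (ho.stronglyMeasurableAtFilter _ _) ho.continuousAt
  have hVd : ∀ t, HasDerivAt V (v t) t := fun t => (hv.integral_hasStrictDerivAt 0 t).hasDerivAt
  have cW : Continuous W := continuous_iff_continuousAt.2 fun t => (hWd t).continuousAt
  have cV : Continuous V := continuous_iff_continuousAt.2 fun t => (hVd t).continuousAt
  have hVV : ∀ s, ∫ t in (-s)..s, v t = V s - V (-s) := fun s =>
    (intervalIntegral.integral_interval_sub_left (hv.intervalIntegrable _ _)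
      (hv.intervalIntegrable _ _)).symm
  have hker : ∀ t ∈ uIcc (-x) x, kernelParam a q κ x t = κ / 2 + k t + κ / 2 * W t := by
    intro t ht
    rw [kernelParam_eq hq hqQ hH κ hx ht]
    simp only [hk, hW, sub_neg_eq_add, ← sub_eq_add_neg]
  have hneg : ∀ g : ℝ → ℂ, ∫ t in (-x)..x, g (-t) = ∫ t in (-x)..x, g t := fun g => by
    rw [intervalIntegral.integral_comp_neg, neg_neg]
  have hWx : W x = 0 := intervalIntegral.integral_same
  have hWnx : W (-x) = 0 := by
    have := intervalIntegral.integral_sub (ck.intervalIntegrable (μ := volume) (-x) x)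
      ((ck.comp continuous_neg).intervalIntegrable (-x) x)
    exact this.trans (sub_eq_zero.2 (hneg k).symm)
  have hparts : ∫ t in (-x)..x, W t * v t = ∫ t in (-x)..x, k t * (V t - V (-t)) := by
    rw [intervalIntegral.integral_mul_deriv_eq_deriv_mul (fun t _ => hWd t) (fun t _ => hVd t)
      (ho.neg.intervalIntegrable _ _) (hv.intervalIntegrable _ _), hWx, hWnx]
    have e1 : ∀ t, -(k t - k (-t)) * V t = k (-t) * V t - k t * V t := fun t => by ring
    have e2 : ∀ t, k t * (V t - V (-t)) = k t * V t - k t * V (-t) := fun t => by ring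
    have e3 := hneg fun t => k t * V (-t)
    simp only [neg_neg] at e3
    simp only [e1, e2]
    have j1 := ((ck.comp continuous_neg).mul cV).intervalIntegrable (μ := volume) (-x) x
    have j2 := (ck.mul cV).intervalIntegrable (μ := volume) (-x) x
    have j3 := (ck.mul (cV.comp continuous_neg)).intervalIntegrable (μ := volume) (-x) x
    have s1 := intervalIntegral.integral_sub j1 j2
    have s2 := intervalIntegral.integral_sub j2 j3
    simp only [Pi.mul_apply, Function.comp_apply] at s1 s2
    rw [s1, s2, ← e3]
    ring
  have hchar : ∀ ψ : ℝ → ℂ, ∫ t in (-x)..x, k t * ψ t =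
      2 * ∫ s in (0 : ℝ)..x, H (x - s) s * ψ (x - 2 * s) := by
    intro ψ
    have := intervalIntegral.integral_comp_sub_mul (a := 0) (b := x) (fun t => k t * ψ t)
      (two_ne_zero (α := ℝ)) x
    rw [show x - 2 * x = -x by ring, show x - 2 * 0 = x by ring] at this
    have e : ∀ s, H (x - s) s * ψ (x - 2 * s) = k (x - 2 * s) * ψ (x - 2 * s) := by
      intro s
      rw [hk]
      dsimp only
      rw [show (x + (x - 2 * s)) / 2 = x - s by ring, show (x - (x - 2 * s)) / 2 = s by ring]
    simp only [e]
    rw [this, Complex.real_smul]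
    push_cast
    ring
  rw [transmutation, planeTransmutation,
    ← hchar fun s => v s + κ / 2 * ∫ t in (-s)..s, v t, intervalIntegral.integral_congr
    (g := fun t => κ / 2 * v t + k t * v t + κ / 2 * (W t * v t))
    (fun t ht => by dsimp only; rw [hker t ht]; ring)]
  have i1 := hv.intervalIntegrable (μ := volume) (-x) x
  have i2 := (ck.mul hv).intervalIntegrable (μ := volume) (-x) x
  have i3 := (cW.mul hv).intervalIntegrable (μ := volume) (-x) x
  have i4 := (ck.mul (cV.sub (cV.comp continuous_neg))).intervalIntegrable (μ := volume) (-x) x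
  have e5 : ∀ t, k t * (v t + κ / 2 * (V t - V (-t))) =
      k t * v t + κ / 2 * (k t * (V t - V (-t))) := fun t => by ring
  simp only [hVV, e5]
  have s1 := intervalIntegral.integral_add ((i1.const_mul (κ / 2)).add i2) (i3.const_mul (κ / 2))
  have s2 := intervalIntegral.integral_add (i1.const_mul (κ / 2)) i2
  have s3 := intervalIntegral.integral_add i2 (i4.const_mul (κ / 2))
  simp only [intervalIntegral.integral_const_mul, Pi.mul_apply, Pi.sub_apply,
    Function.comp_apply] at s1 s2 s3
  rw [s1, s2, s3, hparts, hVV]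
  ring

theorem exists_goursatPlane_extend {a : ℝ} (ha : 0 ≤ a) {q : ℝ → ℂ}
    (hq : ContinuousOn q (Icc (-a) a)) :
    ∃ Q H Hu Hv, EqOn q Q (Icc (-a) a) ∧ GoursatPlane Q H Hu Hv := by
  have haa : -a ≤ a := by linarith
  obtain ⟨H, Hu, Hv, hH⟩ := exists_goursatPlane
    ((continuousOn_iff_continuous_domRestrict.1 hq).Icc_extend' (h := haa))
  exact ⟨_, H, Hu, Hv, fun x hx => (IccExtend_of_mem haa ((Icc (-a) a).domRestrict q) hx).symm, hH⟩

/-- The transmutation operator intertwines `d²/dx²` with `d²/dx² - q`, and prescribes the Cauchy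
data at `0`. The function `y` extends `𝐓_κ v` beyond `[-a, a]`, so that two-sided derivatives make
sense at the end points. -/
theorem exists_transmutation_ode {a : ℝ} (ha : 0 ≤ a) {q : ℝ → ℂ}
    (hq : ContinuousOn q (Icc (-a) a)) (κ : ℂ) {v v' v'' : ℝ → ℂ}
    (hv : ∀ x, HasDerivAt v (v' x) x) (hv' : ∀ x, HasDerivAt v' (v'' x) x)
    (hv'' : Continuous v'') :
    ∃ y y' : ℝ → ℂ, (∀ x, HasDerivAt y (y' x) x) ∧
      (∀ x ∈ Icc (-a) a, y x = transmutation a q κ v x) ∧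
      (∀ x ∈ Icc (-a) a,
        HasDerivAt y' (q x * transmutation a q κ v x + transmutation a q κ v'' x) x) ∧
      y 0 = v 0 ∧ y' 0 = v' 0 + κ * v 0 := by
  obtain ⟨Q, H, Hu, Hv, hqQ, hH⟩ := exists_goursatPlane_extend ha hq
  have cv : Continuous v := continuous_iff_continuousAt.2 fun x => (hv x).continuousAt
  have cv' : Continuous v' := continuous_iff_continuousAt.2 fun x => (hv' x).continuousAt
  have hsym : ∀ (g : ℝ → ℂ), Continuous g → ∀ x,
      HasDerivAt (fun s => ∫ t in (-s)..s, g t) (g x + g (-x)) x := by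
    intro g hg x
    have e : (fun s => ∫ t in (-s)..s, g t) =
        fun s => (∫ t in (0 : ℝ)..s, g t) - ∫ t in (0 : ℝ)..(-s), g t := funext fun s =>
      (intervalIntegral.integral_interval_sub_left (hg.intervalIntegrable _ _)
        (hg.intervalIntegrable _ _)).symm
    rw [e]
    have h1 := (hg.integral_hasStrictDerivAt 0 x).hasDerivAt
    have h2 := (hg.integral_hasStrictDerivAt 0 (-x)).hasDerivAt.scomp x (hasDerivAt_neg x)
    exact (h1.sub h2).congr_deriv (by simp)
  have hint : ∀ x, ∫ t in (-x)..x, v'' t = v' x - v' (-x) := fun x =>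
    intervalIntegral.integral_eq_sub_of_hasDerivAt (fun t _ => hv' t)
      (hv''.intervalIntegrable _ _)
  have hφ : ∀ x, HasDerivAt (fun s => v s + κ / 2 * ∫ t in (-s)..s, v t)
      (v' x + κ / 2 * (v x + v (-x))) x := fun x =>
    (hv x).add ((hsym v cv x).const_mul _)
  have hφ' : ∀ x, HasDerivAt (fun s => v' s + κ / 2 * (v s + v (-s)))
      (v'' x + κ / 2 * ∫ t in (-x)..x, v'' t) x := fun x => by
    have h2 := (hv (-x)).scomp x (hasDerivAt_neg x)
    refine ((hv' x).add (((hv x).add h2).const_mul (κ / 2))).congr_deriv ?_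
    rw [hint, neg_one_smul]
    ring
  have hφ'' : Continuous fun x => v'' x + κ / 2 * ∫ t in (-x)..x, v'' t := by
    simp only [hint]
    fun_prop
  have hφ'c : Continuous fun s => v' s + κ / 2 * (v s + v (-s)) := by fun_prop
  refine ⟨_, _, hH.hasDerivAt_planeTransmutation hφ hφ'c,
    fun x hx => (transmutation_eq_planeTransmutation hq hqQ hH κ cv hx).symm, fun x hx => ?_, ?_, ?_⟩
  · refine (hH.hasDerivAt_planeTransmutationDeriv hφ hφ' hφ'' x).congr_deriv ?_
    rw [transmutation_eq_planeTransmutation hq hqQ hH κ cv hx,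
      transmutation_eq_planeTransmutation hq hqQ hH κ hv'' hx, hqQ hx]
  · simp [planeTransmutation]
  · simp [planeTransmutationDeriv]
    ring

/-! ### The Darboux transformation -/

theorem eq_zero_of_linear_ode {a : ℝ} (ha : 0 < a) {q : ℝ → ℂ}
    (hq : ContinuousOn q (Icc (-a) a)) {y y' : ℝ → ℂ}
    (hy : ∀ x ∈ Icc (-a) a, HasDerivWithinAt y (y' x) (Icc (-a) a) x)
    (hy' : ∀ x ∈ Icc (-a) a, HasDerivWithinAt y' (q x * y x) (Icc (-a) a) x)
    (h0 : y 0 = 0) (h0' : y' 0 = 0) : ∀ x ∈ Icc (-a) a, y x = 0 := by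
  obtain ⟨M, hM⟩ := isCompact_Icc.exists_bound_of_continuousOn hq
  let V : ℝ → ℂ × ℂ → ℂ × ℂ := fun t p => (p.2, q t * p.1)
  have hV : ∀ t ∈ Ioo (-a) a, LipschitzOnWith (max 1 M.toNNReal) (V t) univ := by
    intro t ht
    refine LipschitzOnWith.of_dist_le_mul fun p _ r _ => ?_
    have hMt : ‖q t‖ ≤ M.toNNReal := (hM t (Ioo_subset_Icc_self ht)).trans (Real.le_coe_toNNReal M)
    rw [dist_eq_norm, dist_eq_norm, NNReal.coe_max, NNReal.coe_one]
    have e : V t p - V t r = ((p - r).2, q t * (p - r).1) := by simp [V, mul_sub]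
    rw [e, Prod.norm_def, norm_mul]
    refine max_le ?_ ?_
    · rw [← one_mul ‖(p - r).2‖]
      exact mul_le_mul (le_max_left _ _) (norm_snd_le _) (norm_nonneg _) (by positivity)
    · exact mul_le_mul (hMt.trans (le_max_right _ _)) (norm_fst_le _) (norm_nonneg _)
        (by positivity)
  have hnhds : ∀ t ∈ Ioo (-a) a, Icc (-a) a ∈ 𝓝 t := fun t ht => Icc_mem_nhds ht.1 ht.2
  have hsol := ODE_solution_unique_of_mem_Icc (v := V) (s := fun _ => univ) (t₀ := 0)
    (f := fun t => (y t, y' t)) (g := fun _ => 0) hV ⟨by linarith, ha⟩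
    (fun t ht => ((hy t ht).continuousWithinAt.prodMk (hy' t ht).continuousWithinAt))
    (fun t ht => (((hy t (Ioo_subset_Icc_self ht)).hasDerivAt (hnhds t ht)).prodMk
      ((hy' t (Ioo_subset_Icc_self ht)).hasDerivAt (hnhds t ht))))
    (fun _ _ => mem_univ _) continuousOn_const
    (fun t _ => (hasDerivAt_const t (0 : ℂ × ℂ)).congr_deriv (by simp [V]; rfl))
    (fun _ _ => mem_univ _) (by simp [h0, h0'])
  intro x hx
  exact congrArg Prod.fst (hsol hx)

theorem transmutation_congr {a : ℝ} {q : ℝ → ℂ} {κ : ℂ} {u v : ℝ → ℂ}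
    (huv : EqOn u v (Icc (-a) a)) {x : ℝ} (hx : x ∈ Icc (-a) a) :
    transmutation a q κ u x = transmutation a q κ v x := by
  rw [transmutation, transmutation, huv hx]
  congr 1
  refine intervalIntegral.integral_congr fun t ht => ?_
  have : |t| ≤ a := (abs_le_of_mem_uIcc_neg ht).trans (abs_le.2 hx)
  simp only [huv (abs_le.1 this)]

section Darboux

variable {a : ℝ} {q₁ f : ℝ → ℂ} {h : ℂ}

theorem IsSolutionOn.hasDerivWithinAt (hf : IsSolutionOn a q₁ 0 f) {x : ℝ}
    (hx : x ∈ Icc (-a) a) :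
    HasDerivWithinAt f (derivWithin f (Icc (-a) a) x) (Icc (-a) a) x :=
  (hf.differentiableOn x hx).hasDerivWithinAt

theorem IsSolutionOn.continuousOn_derivWithin {ω : ℂ} (hf : IsSolutionOn a q₁ ω f) :
    ContinuousOn (derivWithin f (Icc (-a) a)) (Icc (-a) a) :=
  fun x hx => (hf.equation x hx).continuousWithinAt

theorem continuousOn_darbouxPotential (hq₁ : ContinuousOn q₁ (Icc (-a) a))
    (hf : IsSolutionOn a q₁ 0 f) (hf_ne : ∀ x ∈ Icc (-a) a, f x ≠ 0) :
    ContinuousOn (darbouxPotential a q₁ f) (Icc (-a) a) :=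
  (continuousOn_const.mul ((hf.continuousOn_derivWithin.div
    hf.differentiableOn.continuousOn hf_ne).pow 2)).sub hq₁

theorem hasDerivWithinAt_integral_mul (ha : 0 ≤ a) {f w : ℝ → ℂ}
    (hf : ContinuousOn f (Icc (-a) a)) (hw : Continuous w) (c : ℂ) {x : ℝ}
    (hx : x ∈ Icc (-a) a) :
    HasDerivWithinAt (fun x => (∫ η in (0 : ℝ)..x, f η * w η) + c) (f x * w x)
      (Icc (-a) a) x := by
  have haa : -a ≤ a := by linarith
  have h0 : (0 : ℝ) ∈ Icc (-a) a := ⟨by linarith, ha⟩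
  let F : ℝ → ℂ := IccExtend haa ((Icc (-a) a).domRestrict f)
  have hF : Continuous F := (continuousOn_iff_continuous_domRestrict.1 hf).Icc_extend' (h := haa)
  have hFf : EqOn F f (Icc (-a) a) := fun x hx => IccExtend_of_mem haa _ hx
  have hint : ∀ x ∈ Icc (-a) a,
      (∫ η in (0 : ℝ)..x, f η * w η) + c = (∫ η in (0 : ℝ)..x, F η * w η) + c := by
    intro x hx
    rw [intervalIntegral.integral_congr fun η hη => ?_]
    simp only [hFf (uIcc_subset_Icc h0 hx hη)]
  have := ((hF.mul hw).integral_hasStrictDerivAt 0 x).hasDerivAt.add_const c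
  rw [← hFf hx]
  exact this.hasDerivWithinAt.congr hint (hint x hx)

theorem hasDerivAt_polynomial (p : Polynomial ℂ) (x : ℝ) :
    HasDerivAt (fun x : ℝ => p.eval (x : ℂ)) (p.derivative.eval (x : ℂ)) x :=
  (p.hasDerivAt (x : ℂ)).comp_ofReal

theorem derivWithin_polynomial (ha : 0 < a) (p : Polynomial ℂ) {x : ℝ} (hx : x ∈ Icc (-a) a) :
    derivWithin (fun x : ℝ => p.eval (x : ℂ)) (Icc (-a) a) x = p.derivative.eval (x : ℂ) :=
  (hasDerivAt_polynomial p x).hasDerivWithinAt.derivWithin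
    (uniqueDiffOn_Icc (by linarith) x hx)

theorem continuous_polynomial (p : Polynomial ℂ) : Continuous fun x : ℝ => p.eval (x : ℂ) :=
  p.continuous.comp Complex.continuous_ofReal

/-- The operator `T₂` intertwines `d²/dx²` with `d²/dx² - q₂` on polynomials, and prescribes the
Cauchy data at `0`. With `w = 𝐓_{1;h} p'` the crucial identity is `f w' - f' w = f T₂ p''`. -/
theorem exists_T₂_ode (ha : 0 < a) (hq₁ : ContinuousOn q₁ (Icc (-a) a))
    (hf : IsSolutionOn a q₁ 0 f) (hf_ne : ∀ x ∈ Icc (-a) a, f x ≠ 0) (hf_zero : f 0 = 1)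
    (hf_deriv : derivWithin f (Icc (-a) a) 0 = h) (p : Polynomial ℂ) :
    ∃ y' : ℝ → ℂ,
      (∀ x ∈ Icc (-a) a, HasDerivWithinAt (T₂ a q₁ f h fun x : ℝ => p.eval (x : ℂ)) (y' x)
        (Icc (-a) a) x) ∧
      (∀ x ∈ Icc (-a) a, HasDerivWithinAt y'
        (darbouxPotential a q₁ f x * T₂ a q₁ f h (fun x : ℝ => p.eval (x : ℂ)) x +
          T₂ a q₁ f h (fun x : ℝ => p.derivative.derivative.eval (x : ℂ)) x) (Icc (-a) a) x) ∧
      T₂ a q₁ f h (fun x : ℝ => p.eval (x : ℂ)) 0 = p.eval 0 ∧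
      y' 0 = p.derivative.eval 0 - h * p.eval 0 := by
  have h0 : (0 : ℝ) ∈ Icc (-a) a := ⟨by linarith, ha.le⟩
  have fc := hf.differentiableOn.continuousOn
  have key : ∀ p : Polynomial ℂ, ∃ w w' G : ℝ → ℂ, (∀ x, HasDerivAt w (w' x) x) ∧
      (∀ x ∈ Icc (-a) a,
        w x = transmutation a q₁ h (fun x : ℝ => p.derivative.eval (x : ℂ)) x) ∧
      (∀ x ∈ Icc (-a) a, HasDerivAt w' (q₁ x * w x + transmutation a q₁ h
        (fun x : ℝ => p.derivative.derivative.derivative.eval (x : ℂ)) x) x) ∧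
      w 0 = p.derivative.eval 0 ∧
      w' 0 = p.derivative.derivative.eval 0 + h * p.derivative.eval 0 ∧
      (∀ x ∈ Icc (-a) a, T₂ a q₁ f h (fun x : ℝ => p.eval (x : ℂ)) x = G x / f x) ∧
      (∀ x ∈ Icc (-a) a, HasDerivWithinAt G (f x * w x) (Icc (-a) a) x) ∧ G 0 = p.eval 0 := by
    intro p
    obtain ⟨w, w', hw, hwT, hw', hw0, hw0'⟩ := exists_transmutation_ode ha.le hq₁ h
      (hasDerivAt_polynomial p.derivative) (hasDerivAt_polynomial p.derivative.derivative)
      (continuous_polynomial p.derivative.derivative.derivative)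
    have cw : Continuous w := continuous_iff_continuousAt.2 fun x => (hw x).continuousAt
    refine ⟨w, w', fun x => (∫ η in (0 : ℝ)..x, f η * w η) + p.eval 0, hw, hwT, fun x hx => ?_,
      by simpa using hw0, by simpa using hw0', fun x hx => ?_,
      fun x hx => hasDerivWithinAt_integral_mul ha.le fc cw _ hx, by simp⟩
    · rw [hwT x hx]; exact hw' x hx
    · rw [T₂, one_div_mul_eq_div, Complex.ofReal_zero]
      congr 2
      refine intervalIntegral.integral_congr fun η hη => ?_
      have hη' := uIcc_subset_Icc h0 hx hη
      simp only [hwT η hη']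
      rw [transmutation_congr (fun t ht => derivWithin_polynomial ha p ht) hη']
  obtain ⟨w, w', G, hw, hwT, hw', hw0, hw0', hTG, hG, hG0⟩ := key p
  obtain ⟨w₂, -, G₂, -, hwT₂, -, -, -, hTG₂, hG₂, hG₂0⟩ := key p.derivative.derivative
  set f' := derivWithin f (Icc (-a) a) with hf'
  have hfd : ∀ x ∈ Icc (-a) a, HasDerivWithinAt f (f' x) (Icc (-a) a) x :=
    fun x hx => hf.hasDerivWithinAt hx
  have hfd' : ∀ x ∈ Icc (-a) a, HasDerivWithinAt f' (q₁ x * f x) (Icc (-a) a) x :=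
    fun x hx => (hf.equation x hx).congr_deriv (by simp)
  have hwr : ∀ x ∈ Icc (-a) a, f x * w' x - f' x * w x = G₂ x := by
    intro x hx
    have hd : ∀ t ∈ Icc (-a) a,
        HasDerivWithinAt (fun t => f t * w' t - f' t * w t - G₂ t) 0 (Icc (-a) a) t := by
      intro t ht
      have := (((hfd t ht).mul (hw' t ht).hasDerivWithinAt).sub
        ((hfd' t ht).mul (hw t).hasDerivWithinAt)).sub (hG₂ t ht)
      refine this.congr_deriv ?_
      rw [hwT₂ t ht]
      ring
    have hb := (convex_Icc (-a) a).norm_image_sub_le_of_norm_hasDerivWithin_le (C := 0) hd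
      (fun _ _ => by simp) h0 hx
    rw [zero_mul, norm_le_zero_iff, hf_zero, hf_deriv, hw0, hw0', hG₂0, sub_eq_zero] at hb
    linear_combination hb
  refine ⟨fun x => w x - f' x * G x / f x ^ 2, fun x hx => ?_, fun x hx => ?_, ?_, ?_⟩
  · have hne := hf_ne x hx
    refine (((hG x hx).div (hfd x hx) hne).congr hTG (hTG x hx)).congr_deriv ?_
    field_simp
  · have hne := hf_ne x hx
    have := (hw x).hasDerivWithinAt.sub
      (((hfd' x hx).mul (hG x hx)).div ((hfd x hx).pow 2) (pow_ne_zero 2 hne))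
    refine this.congr_deriv ?_
    rw [hTG x hx, hTG₂ x hx, ← hwr x hx, darbouxPotential, ← hf']
    simp only [Pi.mul_apply, Pi.pow_apply]
    field_simp
    push_cast
    ring
  · rw [hTG 0 h0, hG0, hf_zero, div_one]
  · simp [hw0, hf_deriv, hG0, hf_zero]

theorem T₂_eq_transmutation_polynomial (ha : 0 < a) (hq₁ : ContinuousOn q₁ (Icc (-a) a))
    (hf : IsSolutionOn a q₁ 0 f) (hf_ne : ∀ x ∈ Icc (-a) a, f x ≠ 0) (hf_zero : f 0 = 1)
    (hf_deriv : derivWithin f (Icc (-a) a) 0 = h) (p : Polynomial ℂ) :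
    ∀ x ∈ Icc (-a) a, T₂ a q₁ f h (fun x : ℝ => p.eval (x : ℂ)) x =
      transmutation a (darbouxPotential a q₁ f) (-h) (fun x : ℝ => p.eval (x : ℂ)) x := by
  have hq₂ := continuousOn_darbouxPotential hq₁ hf hf_ne
  -- Both sides intertwine the same operators, so their difference `E` satisfies
  -- `E[p]'' = q₂ E[p] + E[p'']`: it vanishes by induction on the order of the derivative of `p`
  -- that vanishes.
  suffices H : ∀ (n : ℕ) (p : Polynomial ℂ), Polynomial.derivative^[n] p = 0 →
      ∀ x ∈ Icc (-a) a, T₂ a q₁ f h (fun x : ℝ => p.eval (x : ℂ)) x =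
        transmutation a (darbouxPotential a q₁ f) (-h) (fun x : ℝ => p.eval (x : ℂ)) x from
    H (p.natDegree + 1) p (Polynomial.iterate_derivative_eq_zero (Nat.lt_succ_self _))
  intro n
  induction n with
  | zero =>
    intro p hp x hx
    obtain rfl : p = 0 := hp
    simp [T₂, transmutation]
  | succ n ih =>
    intro p hp
    have hp2 : Polynomial.derivative^[n] p.derivative.derivative = 0 := by
      rw [Function.iterate_succ_apply] at hp
      rw [← Function.iterate_succ_apply, Function.iterate_succ_apply', hp,
        Polynomial.derivative_zero]
    obtain ⟨y', hy, hy', hy0, hy0'⟩ := exists_T₂_ode ha hq₁ hf hf_ne hf_zero hf_deriv p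
    obtain ⟨z, z', hz, hzT, hz', hz0, hz0'⟩ := exists_transmutation_ode ha.le hq₂ (-h)
      (hasDerivAt_polynomial p) (hasDerivAt_polynomial p.derivative)
      (continuous_polynomial p.derivative.derivative)
    have hE := eq_zero_of_linear_ode ha hq₂
      (y := fun x => T₂ a q₁ f h (fun x : ℝ => p.eval (x : ℂ)) x - z x)
      (y' := fun x => y' x - z' x)
      (fun x hx => (hy x hx).sub (hz x).hasDerivWithinAt)
      (fun x hx => ((hy' x hx).sub (hz' x hx).hasDerivWithinAt).congr_deriv (by
        rw [hzT x hx, ih _ hp2 x hx]; ring))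
      (by simp [hy0, hz0]) (by simp [hy0', hz0']; ring)
    intro x hx
    rw [← hzT x hx]
    exact sub_eq_zero.1 (hE x hx)

end Darboux

/-! ### Continuity of the operators and approximation by polynomials -/

section Bounds

variable {a : ℝ} {q : ℝ → ℂ}

theorem mem_Icc_of_mem_uIcc_neg {x t : ℝ} (hx : x ∈ Icc (-a) a) (ht : t ∈ uIcc (-x) x) :
    t ∈ Icc (-a) a :=
  abs_le.1 ((abs_le_of_mem_uIcc_neg ht).trans (abs_le.2 hx))

theorem exists_continuous_kernelParam (ha : 0 ≤ a) (hq : ContinuousOn q (Icc (-a) a)) (κ : ℂ) :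
    ∃ K : ℝ → ℝ → ℂ, Continuous (Function.uncurry K) ∧
      ∀ x ∈ Icc (-a) a, ∀ t ∈ uIcc (-x) x, kernelParam a q κ x t = K x t := by
  obtain ⟨Q, H, Hu, Hv, hqQ, hH⟩ := exists_goursatPlane_extend ha hq
  refine ⟨_, ?_, fun x hx t ht => kernelParam_eq hq hqQ hH κ hx ht⟩
  refine (continuous_const.add (hH.continuous.comp (by fun_prop :
    Continuous fun p : ℝ × ℝ => ((p.1 + p.2) / 2, (p.1 - p.2) / 2)))).add
    (continuous_const.mul (continuous_intervalIntegral_param (X := ℝ × ℝ)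
      (F := fun p s => H ((p.1 + s) / 2) ((p.1 - s) / 2) - H ((p.1 - s) / 2) ((p.1 + s) / 2))
      ?_ continuous_snd continuous_fst))
  exact (hH.continuous.comp (by fun_prop :
    Continuous fun p : (ℝ × ℝ) × ℝ => ((p.1.1 + p.2) / 2, (p.1.1 - p.2) / 2))).sub
    (hH.continuous.comp (by fun_prop :
    Continuous fun p : (ℝ × ℝ) × ℝ => ((p.1.1 - p.2) / 2, (p.1.1 + p.2) / 2)))

theorem intervalIntegrable_kernelParam_mul (ha : 0 ≤ a) (hq : ContinuousOn q (Icc (-a) a)) (κ : ℂ)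
    {u : ℝ → ℂ} (hu : ContinuousOn u (Icc (-a) a)) {x : ℝ} (hx : x ∈ Icc (-a) a) :
    IntervalIntegrable (fun t => kernelParam a q κ x t * u t) volume (-x) x := by
  obtain ⟨K, hK, hKq⟩ := exists_continuous_kernelParam ha hq κ
  have hKx : ContinuousOn (kernelParam a q κ x) (uIcc (-x) x) :=
    (hK.comp (by fun_prop : Continuous fun t => (x, t))).continuousOn.congr (hKq x hx)
  exact (hKx.mul (hu.mono fun t ht => mem_Icc_of_mem_uIcc_neg hx ht)).intervalIntegrable

theorem transmutation_sub (ha : 0 ≤ a) (hq : ContinuousOn q (Icc (-a) a)) (κ : ℂ) {u v : ℝ → ℂ}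
    (hu : ContinuousOn u (Icc (-a) a)) (hv : ContinuousOn v (Icc (-a) a)) {x : ℝ}
    (hx : x ∈ Icc (-a) a) :
    transmutation a q κ (fun t => u t - v t) x =
      transmutation a q κ u x - transmutation a q κ v x := by
  simp only [transmutation, mul_sub]
  rw [intervalIntegral.integral_sub (intervalIntegrable_kernelParam_mul ha hq κ hu hx)
    (intervalIntegrable_kernelParam_mul ha hq κ hv hx)]
  ring

theorem continuousOn_transmutation (ha : 0 ≤ a) (hq : ContinuousOn q (Icc (-a) a)) (κ : ℂ)
    {u : ℝ → ℂ} (hu : ContinuousOn u (Icc (-a) a)) :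
    ContinuousOn (transmutation a q κ u) (Icc (-a) a) := by
  obtain ⟨K, hK, hKq⟩ := exists_continuous_kernelParam ha hq κ
  have haa : -a ≤ a := by linarith
  let U : ℝ → ℂ := IccExtend haa ((Icc (-a) a).domRestrict u)
  have hU : Continuous U := (continuousOn_iff_continuous_domRestrict.1 hu).Icc_extend' (h := haa)
  have hUu : EqOn u U (Icc (-a) a) := fun x hx =>
    (IccExtend_of_mem haa ((Icc (-a) a).domRestrict u) hx).symm
  have hc : Continuous fun x => U x + ∫ t in (-x)..x, K x t * U t :=
    hU.add (continuous_intervalIntegral_param (F := fun x t => K x t * U t)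
      (hK.mul (hU.comp continuous_snd)) continuous_neg continuous_id)
  refine hc.continuousOn.congr fun x hx => ?_
  rw [transmutation_congr hUu hx, transmutation]
  congr 1
  refine intervalIntegral.integral_congr fun t ht => ?_
  simp only [hKq x hx t ht]

theorem exists_bound_transmutation (ha : 0 ≤ a) (hq : ContinuousOn q (Icc (-a) a)) (κ : ℂ) :
    ∃ C : ℝ, 0 ≤ C ∧ ∀ (v : ℝ → ℂ) (ε : ℝ), (∀ x ∈ Icc (-a) a, ‖v x‖ ≤ ε) →
      ∀ x ∈ Icc (-a) a, ‖transmutation a q κ v x‖ ≤ C * ε := by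
  obtain ⟨K, hK, hKq⟩ := exists_continuous_kernelParam ha hq κ
  obtain ⟨M, hM⟩ := ((isCompact_Icc (a := -a) (b := a)).prod
    (isCompact_Icc (a := -a) (b := a))).exists_bound_of_continuousOn hK.continuousOn
  have h0 : (0 : ℝ) ∈ Icc (-a) a := ⟨by linarith, ha⟩
  have hM0 : 0 ≤ M := (norm_nonneg _).trans (hM (0, 0) ⟨h0, h0⟩)
  refine ⟨1 + M * (2 * a), by positivity, fun v ε hv x hx => ?_⟩
  have hε : 0 ≤ ε := (norm_nonneg _).trans (hv x hx)
  have hb : ‖∫ t in (-x)..x, kernelParam a q κ x t * v t‖ ≤ M * ε * |x - -x| := by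
    refine intervalIntegral.norm_integral_le_of_norm_le_const fun t ht => ?_
    have ht' := mem_Icc_of_mem_uIcc_neg hx (uIoc_subset_uIcc ht)
    rw [hKq x hx t (uIoc_subset_uIcc ht), norm_mul]
    exact mul_le_mul (hM (x, t) ⟨hx, ht'⟩) (hv t ht') (norm_nonneg _) hM0
  have hx2 : |x - -x| ≤ 2 * a := by
    rw [sub_neg_eq_add, ← two_mul, abs_mul, abs_two]
    exact mul_le_mul_of_nonneg_left (abs_le.2 hx) zero_le_two
  calc ‖transmutation a q κ v x‖ ≤ ‖v x‖ + ‖∫ t in (-x)..x, kernelParam a q κ x t * v t‖ :=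
        norm_add_le _ _
    _ ≤ ε + M * ε * (2 * a) := add_le_add (hv x hx) (hb.trans (by gcongr))
    _ = (1 + M * (2 * a)) * ε := by ring

end Bounds

theorem exists_complex_polynomial_near {a b : ℝ} {g : ℝ → ℂ} (hg : ContinuousOn g (Icc a b))
    {ε : ℝ} (hε : 0 < ε) :
    ∃ p : Polynomial ℂ, ∀ x ∈ Icc a b, ‖g x - p.eval (x : ℂ)‖ ≤ ε := by
  obtain ⟨r, hr⟩ := exists_polynomial_near_of_continuousOn a b (fun x => (g x).re)
    (Complex.continuous_re.comp_continuousOn hg) (ε / 2) (by positivity)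
  obtain ⟨s, hs⟩ := exists_polynomial_near_of_continuousOn a b (fun x => (g x).im)
    (Complex.continuous_im.comp_continuousOn hg) (ε / 2) (by positivity)
  refine ⟨r.map Complex.ofRealHom + Polynomial.C Complex.I * s.map Complex.ofRealHom,
    fun x hx => ?_⟩
  have hev : ∀ t : Polynomial ℝ, (t.map Complex.ofRealHom).eval (x : ℂ) = (t.eval x : ℝ) :=
    fun t => Polynomial.eval_map_apply (f := Complex.ofRealHom) x
  rw [Polynomial.eval_add, Polynomial.eval_mul, Polynomial.eval_C, hev, hev]
  refine (Complex.norm_le_abs_re_add_abs_im _).trans ?_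
  have h1 := (hr x hx).le
  have h2 := (hs x hx).le
  rw [abs_sub_comm] at h1 h2
  simp
  linarith

theorem exists_polynomial_antiderivative (p : Polynomial ℂ) (c : ℂ) :
    ∃ P : Polynomial ℂ, P.derivative = p ∧ P.eval 0 = c := by
  suffices h : ∃ P : Polynomial ℂ, P.derivative = p by
    obtain ⟨P, hP⟩ := h
    exact ⟨P + Polynomial.C (c - P.eval 0), by simp [hP], by simp⟩
  induction p using Polynomial.induction_on' with
  | add p r hp hr =>
    obtain ⟨P, rfl⟩ := hp
    obtain ⟨R, rfl⟩ := hr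
    exact ⟨P + R, Polynomial.derivative_add⟩
  | monomial n b =>
    refine ⟨Polynomial.monomial (n + 1) (b / (n + 1)), ?_⟩
    rw [Polynomial.derivative_monomial, Nat.add_sub_cancel, Nat.cast_succ,
      div_mul_cancel₀ _ (Nat.cast_add_one_ne_zero n)]

theorem T₂_eq_transmutation {a : ℝ} {q₁ f : ℝ → ℂ} {h : ℂ} (ha : 0 < a)
    (hq₁ : ContinuousOn q₁ (Icc (-a) a))
    (hf : IsSolutionOn a q₁ 0 f) (hf_ne : ∀ x ∈ Icc (-a) a, f x ≠ 0) (hf_zero : f 0 = 1)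
    (hf_deriv : derivWithin f (Icc (-a) a) 0 = h) {u : ℝ → ℂ}
    (hu : ContDiffOn ℝ 1 u (Icc (-a) a)) {x : ℝ} (hx : x ∈ Icc (-a) a) :
    T₂ a q₁ f h u x = transmutation a (darbouxPotential a q₁ f) (-h) u x := by
  have h0 : (0 : ℝ) ∈ Icc (-a) a := ⟨by linarith, ha.le⟩
  have hq₂ := continuousOn_darbouxPotential hq₁ hf hf_ne
  have fc := hf.differentiableOn.continuousOn
  have hu' : ContinuousOn (derivWithin u (Icc (-a) a)) (Icc (-a) a) :=
    hu.continuousOn_derivWithin (uniqueDiffOn_Icc (by linarith)) le_rfl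
  obtain ⟨C₁, hC₁, hT₁⟩ := exists_bound_transmutation ha.le hq₁ h
  obtain ⟨C₂, hC₂, hT₂⟩ := exists_bound_transmutation ha.le hq₂ (-h)
  obtain ⟨M, hM⟩ := isCompact_Icc.exists_bound_of_continuousOn fc
  have hM0 : 0 ≤ M := (norm_nonneg _).trans (hM 0 h0)
  set A : ℝ := ‖1 / f x‖ * (M * C₁ * a) + C₂ * a with hA
  have hA0 : 0 ≤ A := by positivity
  -- Approximating `u'` within `ε` by a polynomial changes each side by at most a multiple of `ε`.
  have key : ∀ ε : ℝ, 0 < ε →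
      ‖T₂ a q₁ f h u x - transmutation a (darbouxPotential a q₁ f) (-h) u x‖ ≤ A * ε := by
    intro ε hε
    obtain ⟨p, hp⟩ := exists_complex_polynomial_near hu' hε
    obtain ⟨P, rfl, hP0⟩ := exists_polynomial_antiderivative p (u 0)
    have hPd : EqOn (derivWithin (fun x : ℝ => P.eval (x : ℂ)) (Icc (-a) a))
        (fun x : ℝ => P.derivative.eval (x : ℂ)) (Icc (-a) a) :=
      fun t ht => derivWithin_polynomial ha P ht
    have huP : ∀ t ∈ Icc (-a) a, ‖u t - P.eval (t : ℂ)‖ ≤ a * ε := by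
      intro t ht
      have := (convex_Icc (-a) a).norm_image_sub_le_of_norm_hasDerivWithin_le
        (f := fun t => u t - P.eval (t : ℂ))
        (fun t ht => ((hu.differentiableOn one_ne_zero t ht).hasDerivWithinAt.sub
          (hasDerivAt_polynomial P t).hasDerivWithinAt)) hp h0 ht
      rw [Complex.ofReal_zero, hP0, sub_self, sub_zero, sub_zero] at this
      refine this.trans ?_
      rw [mul_comm a]
      exact mul_le_mul_of_nonneg_left (abs_le.2 ht) hε.le
    have hpc := (continuous_polynomial P.derivative).continuousOn (s := Icc (-a) a)
    have hint : ∀ v : ℝ → ℂ, ContinuousOn v (Icc (-a) a) →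
        IntervalIntegrable (fun η => f η * transmutation a q₁ h v η) volume 0 x := fun v hv =>
      ((fc.mul (continuousOn_transmutation ha.le hq₁ h hv)).mono
        (uIcc_subset_Icc h0 hx)).intervalIntegrable
    have e1 : T₂ a q₁ f h u x - T₂ a q₁ f h (fun x : ℝ => P.eval (x : ℂ)) x =
        1 / f x * ∫ η in (0 : ℝ)..x, f η * transmutation a q₁ h
          (fun t => derivWithin u (Icc (-a) a) t - P.derivative.eval (t : ℂ)) η := by
      have eP : ∫ η in (0 : ℝ)..x, f η * transmutation a q₁ h
            (derivWithin (fun x : ℝ => P.eval (x : ℂ)) (Icc (-a) a)) η =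
          ∫ η in (0 : ℝ)..x, f η * transmutation a q₁ h
            (fun x : ℝ => P.derivative.eval (x : ℂ)) η :=
        intervalIntegral.integral_congr fun η hη => by
          simp only [transmutation_congr hPd (uIcc_subset_Icc h0 hx hη)]
      have eS : ∫ η in (0 : ℝ)..x, f η * transmutation a q₁ h
            (fun t => derivWithin u (Icc (-a) a) t - P.derivative.eval (t : ℂ)) η =
          ∫ η in (0 : ℝ)..x, (f η * transmutation a q₁ h (derivWithin u (Icc (-a) a)) η -
            f η * transmutation a q₁ h (fun x : ℝ => P.derivative.eval (x : ℂ)) η) :=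
        intervalIntegral.integral_congr fun η hη => by
          simp only [transmutation_sub ha.le hq₁ h hu' hpc (uIcc_subset_Icc h0 hx hη), mul_sub]
      rw [eS, intervalIntegral.integral_sub (hint _ hu') (hint _ hpc), T₂, T₂, eP,
        Complex.ofReal_zero, hP0]
      ring
    have e2 : transmutation a (darbouxPotential a q₁ f) (-h) u x -
        transmutation a (darbouxPotential a q₁ f) (-h) (fun x : ℝ => P.eval (x : ℂ)) x =
        transmutation a (darbouxPotential a q₁ f) (-h) (fun t => u t - P.eval (t : ℂ)) x :=
      (transmutation_sub ha.le hq₂ (-h) hu.continuousOn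
        (continuous_polynomial P).continuousOn hx).symm
    have b1 : ‖∫ η in (0 : ℝ)..x, f η * transmutation a q₁ h
        (fun t => derivWithin u (Icc (-a) a) t - P.derivative.eval (t : ℂ)) η‖ ≤
        M * (C₁ * ε) * a := by
      refine (intervalIntegral.norm_integral_le_of_norm_le_const
        (C := M * (C₁ * ε)) fun η hη => ?_).trans ?_
      · have hη' := uIcc_subset_Icc h0 hx (uIoc_subset_uIcc hη)
        rw [norm_mul]
        exact mul_le_mul (hM η hη') (hT₁ _ ε hp η hη') (norm_nonneg _) hM0
      · rw [sub_zero]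
        exact mul_le_mul_of_nonneg_left (abs_le.2 hx) (by positivity)
    have hPeq := T₂_eq_transmutation_polynomial ha hq₁ hf hf_ne hf_zero hf_deriv P x hx
    calc _ = ‖(T₂ a q₁ f h u x - T₂ a q₁ f h (fun x : ℝ => P.eval (x : ℂ)) x) -
          (transmutation a (darbouxPotential a q₁ f) (-h) u x -
            transmutation a (darbouxPotential a q₁ f) (-h) (fun x : ℝ => P.eval (x : ℂ)) x)‖ := by
          rw [hPeq]; congr 1; ring
      _ ≤ ‖1 / f x‖ * (M * (C₁ * ε) * a) + C₂ * (a * ε) := by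
          refine (norm_sub_le _ _).trans (add_le_add ?_ ?_)
          · rw [e1, norm_mul]
            exact mul_le_mul_of_nonneg_left b1 (norm_nonneg _)
          · rw [e2]
            exact hT₂ _ _ huP x hx
      _ = A * ε := by rw [hA]; ring
  rw [← sub_eq_zero, ← norm_le_zero_iff]
  refine le_of_forall_pos_le_add fun δ hδ => (key (δ / (A + 1)) (by positivity)).trans ?_
  rw [zero_add, mul_div_assoc', div_le_iff₀ (by positivity)]
  nlinarith

/-- Solutions are of class `C¹`, so the identity for `C¹` functions covers them. -/
theorem IsSolutionOn.contDiffOn {a : ℝ} {q : ℝ → ℂ} {ω : ℂ} {u : ℝ → ℂ}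
    (hu : IsSolutionOn a q ω u) (ha : 0 < a) : ContDiffOn ℝ 1 u (Icc (-a) a) := by
  have := (contDiffOn_succ_iff_derivWithin (n := 0) (f := u) (𝕜 := ℝ)
    (uniqueDiffOn_Icc (by linarith : -a < a))).2
    ⟨hu.differentiableOn, by simp, contDiffOn_zero.2 hu.continuousOn_derivWithin⟩
  simpa using this

end Transmutation

theorem mainTheorem4 (a : ℝ) (ha : 0 < a) (q₁ f : ℝ → ℂ) (h : ℂ)
    (hq₁ : ContinuousOn q₁ (Set.Icc (-a) a))
    (hf : Transmutation.IsSolutionOn a q₁ 0 f)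
    (hf_ne : ∀ x ∈ Set.Icc (-a) a, f x ≠ 0)
    (hf_zero : f 0 = 1)
    (hf_deriv : derivWithin f (Set.Icc (-a) a) 0 = h) :
    (∀ (ω : ℂ) (u : ℝ → ℂ), Transmutation.IsSolutionOn a 0 ω u →
      ∀ x ∈ Set.Icc (-a) a,
        Transmutation.T₂ a q₁ f h u x =
          Transmutation.transmutation a (Transmutation.darbouxPotential a q₁ f) (-h) u x) ∧
    (∀ u : ℝ → ℂ, ContDiffOn ℝ 1 u (Set.Icc (-a) a) →
      ∀ x ∈ Set.Icc (-a) a,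
        Transmutation.T₂ a q₁ f h u x =
          Transmutation.transmutation a (Transmutation.darbouxPotential a q₁ f) (-h) u x) :=
  ⟨fun _ _ hu _ hx => Transmutation.T₂_eq_transmutation ha hq₁ hf hf_ne hf_zero hf_deriv
      (hu.contDiffOn ha) hx,
    fun _ hu _ hx => Transmutation.T₂_eq_transmutation ha hq₁ hf hf_ne hf_zero hf_deriv hu hx⟩
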